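/- Let $L>0$, $x_1\in\mathbb{R}$, $Y=[-\tfrac L2,\tfrac L2]\times\mathbb{R}^2$ and $e_1=(1,0,0)$. Let $D_1,D_2\subset\mathbb{R}^3$ be bounded open sets with disjoint closures contained in the interior of $Y$, such that $D_1$ and $D_2$ are invariant under reflection in the planes $\{-x_1\}\times\mathbb{R}^2$ and $\{x_1\}\times\mathbb{R}^2$ respectively, and such that $D=D_1\cup D_2$ satisfies $D=-D$. Put $d=2x_1$, $d'=L-d$ and $\mathcal{C}=\bigcup_{m\in\mathbb{Z}}(D+mLe_1)$. For $\alpha\in\mathbb{R}$ and $j=1,2$ let $V_j^\alpha$ be the solution (unique when it exists; for sufficiently regular boundaries it exists for all $\alpha\notin\frac{2\pi}{L}\mathbb{Z}$) of the following problem: $V_j^\alpha:\mathbb{R}^3\setminus\mathcal{C}\to\mathbb{C}$ is continuous, $\Delta V_j^\alpha=0$ in $\mathbb{R}^3\setminus\overline{\mathcal{C}}$, $V_j^\alpha=\delta_{ij}$ on $\partial D_i$ for $i=1,2$, $V_j^\alpha(x+mLe_1)=e^{\mathrm{i}\alpha mL}V_j^\alpha(x)$ for all $m\in\mathbb{Z}$,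 and $V_j^\alpha(x)=O\big((x_2^2+x_3^2)^{-1/2}\big)$ as $x_2^2+x_3^2\to\infty$, uniformly in the first coordinate. Define the quasiperiodic capacitance matrix by $$C_{ij}^\alpha=\int_{Y\setminus\overline{\mathcal{C}}}\overline{\nabla V_i^\alpha}\cdot\nabla V_j^\alpha\,\mathrm{d}x,\qquad i,j=1,2,$$ (here $Y\setminus\overline{\mathcal C}=Y\setminus\overline D$). Let $D'=D_1'\cup D_2'$ be the complementary dimer, obtained by swapping $d$ and $d'$: $D_1'=D_1+\tfrac{d-d'}{2}e_1$ and $D_2'=D_2+\tfrac{d'-d}{2}e_1$. Let ${C_{12}^\alpha}'$ be the quantity defined as $C_{12}^\alpha$, with $D_1',D_2'$ in place of $D_1,D_2$. Then: 1. $D_1'$ and $D_2'$ are the images of $D_1$ and $D_2$ under reflection in the planes $\{-\tfrac L4\}\times\mathbb{R}^2$ and $\{\tfrac L4\}\times\mathbb{R}^2$ respectively. 2. For every $\alpha\in\mathbb{R}$ for which $V_1^\alpha$ and $V_2^\alpha$ exist, ${C_{12}^{\alpha}}'=e^{-\mathrm{i}\alpha L}\,\overline{C_{12}^\alpha}$.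 3. If $d=d'=\tfrac L2$, and if $V_1^{\pi/L}$ and $V_2^{\pi/L}$ exist, then $C_{12}^{\pi/L}=0$. -/

import Mathlib

noncomputable section

namespace ResonatorChain

/-- Three-dimensional Euclidean space; the coordinates `x 0, x 1, x 2` are the usual
`x₁, x₂, x₃`. -/
abbrev E3 : Type := EuclideanSpace ℝ (Fin 3)

/-- The unit vector along the axis of the chain. -/
def e₁ : E3 := EuclideanSpace.single 0 1

/-- The distance `√(x₂² + x₃²)` to the axis of the chain. -/
def axisDist (x : E3) : ℝ := Real.sqrt (x 1 ^ 2 + x 2 ^ 2)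

/-- Reflection in the plane `{c} × ℝ²`. -/
def planeReflection (c : ℝ) (x : E3) : E3 := x + (2 * (c - x 0)) • e₁

/-- The unit cell `Y = [-L/2, L/2] × ℝ²`. -/
def unitCell (L : ℝ) : Set E3 := {x | x 0 ∈ Set.Icc (-(L / 2)) (L / 2)}

/-- The full crystal: the union of all translates of `D₁ ∪ D₂` by `(mL, 0, 0)`, `m ∈ ℤ`. The
resonators `D₁, D₂` are `D 0, D 1`. -/
def crystal (L : ℝ) (D : Fin 2 → Set E3) : Set E3 :=
  {x | ∃ (m : ℤ) (i : Fin 2), x - ((m : ℝ) * L) • e₁ ∈ D i}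

/-- The geometric assumptions on the dimer `D₁ ∪ D₂` in the unit cell of length `L`: the
resonators are bounded open sets with disjoint closures, contained in the interior of the unit
cell; `D₁` and `D₂` are symmetric under reflection in the planes `{-x₁} × ℝ²` and `{x₁} × ℝ²`
respectively; and the dimer is symmetric under `x ↦ -x`. Neither connectedness of the resonators
nor regularity of their boundaries is required. -/
structure IsSymmetricDimer (L x₁ : ℝ) (D : Fin 2 → Set E3) : Prop where
  isOpen : ∀ i, IsOpen (D i)
  isBounded : ∀ i, Bornology.IsBounded (D i)
  closure_subset : ∀ i, closure (D i) ⊆ {x | x 0 ∈ Set.Ioo (-(L / 2)) (L / 2)}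
  disjoint : Disjoint (closure (D 0)) (closure (D 1))
  reflection_left : planeReflection (-x₁) '' D 0 = D 0
  reflection_right : planeReflection x₁ '' D 1 = D 1
  neg_mem_iff : ∀ x, -x ∈ D 0 ∪ D 1 ↔ x ∈ D 0 ∪ D 1

/-- The separation `d` of the two resonators within a unit cell, along the axis. -/
def separation (x₁ : ℝ) : ℝ := 2 * x₁

/-- The separation `d'` of neighbouring resonators across the boundary of the unit cell. -/
def separation' (L x₁ : ℝ) : ℝ := L - separation x₁

/-- The complementary dimer, in which `d` and `d'` are swapped: `D₁` and `D₂` are translated along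
the axis so that their planes of symmetry move from `{-d/2} × ℝ²` and `{d/2} × ℝ²` to
`{-d'/2} × ℝ²` and `{d'/2} × ℝ²`. -/
def complementaryDimer (L x₁ : ℝ) (D : Fin 2 → Set E3) : Fin 2 → Set E3 :=
  ![(fun x => x + ((separation x₁ - separation' L x₁) / 2) • e₁) '' D 0,
    (fun x => x + ((separation' L x₁ - separation x₁) / 2) • e₁) '' D 1]

/-- `V` solves the boundary value problem that defines `V_j^α`. Only the values of `V` outside the
(open) crystal matter. Harmonicity is required in the whole exterior of the crystal, in particular
across the boundary between neighbouring cells. -/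
structure IsPotential (L α : ℝ) (D : Fin 2 → Set E3) (j : Fin 2) (V : E3 → ℂ) : Prop where
  continuousOn : ContinuousOn V (crystal L D)ᶜ
  harmonic : InnerProductSpace.HarmonicOnNhd V (closure (crystal L D))ᶜ
  boundary : ∀ i, ∀ x ∈ frontier (D i), V x = if i = j then 1 else 0
  quasiperiodic : ∀ x ∉ crystal L D, ∀ m : ℤ,
    V (x + ((m : ℝ) * L) • e₁) = Complex.exp (Complex.I * α * m * L) * V x
  decay : ∃ K R : ℝ, 0 < R ∧ ∀ x ∉ crystal L D, R ≤ axisDist x → ‖V x‖ ≤ K / axisDist x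

open Classical in
/-- The function `V_j^α`: the solution of the boundary value problem, which is unique outside the
crystal. It exists for every `α ∉ (2π/L)ℤ` if the boundaries are regular enough; where there is no
solution the convention is `0`. -/
def potential (L α : ℝ) (D : Fin 2 → Set E3) (j : Fin 2) : E3 → ℂ :=
  if h : ∃ V, IsPotential L α D j V then h.choose else 0

/-- The partial derivative `∂V/∂x_k`. -/
def partialDeriv (k : Fin 3) (V : E3 → ℂ) (x : E3) : ℂ :=
  fderiv ℝ V x (EuclideanSpace.single k 1)

/-- The quasiperiodic capacitance matrix: the integral of `conj (∇V_i^α) · ∇V_j^α` over the part of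
the unit cell outside the closed crystal. For a dimer whose closure lies in the interior of `Y` that
region is `Y` without the closure of `D`. -/
def capacitance (L α : ℝ) (D : Fin 2 → Set E3) : Matrix (Fin 2) (Fin 2) ℂ :=
  Matrix.of fun i j =>
    ∫ x in unitCell L \ closure (crystal L D),
      ∑ k : Fin 3, starRingEnd ℂ (partialDeriv k (potential L α D i) x) *
        partialDeriv k (potential L α D j) x

end ResonatorChain

end

/-! Each resonator is symmetric in its own plane, so translating it by `2 * (b - a)` is the same as
reflecting it in a plane shifted by `b - a`; this is the first claim. The planes at `-L/4` and `L/4`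
differ by half a period, so modulo `L` one reflection, in the plane at `L/4`, carries the whole
crystal to the complementary one. A reflection turns quasimomentum `α` into `-α`, and complex
conjugation turns it back. Hence the conjugate of the reflected potential, times a phase for the
cell shift of the resonator, solves the complementary problem (`IsPotential.reflect`). A maximum
principle gives uniqueness (`IsPotential.unique`), so this is the potential. The energy density is
periodic, so the reflected cell may be replaced by `Y`, which gives `capacitance_reflect` and the
second claim. At `α = π/L` the phases are `±1`, so conjugates of potentials are potentials and the
capacitance is real. If `d = d'`, the dimer is its own complement and `C₁₂ = -C₁₂`. -/

open InnerProductSpace Topology Filter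

/-! ### Laplacians at local maxima and under isometries -/

/-- A positive second derivative would make `t` a local minimum as well, so `φ` would be locally
constant. -/
theorem IsLocalMax.deriv_deriv_nonpos {φ : ℝ → ℝ} {t : ℝ} (h : IsLocalMax φ t)
    (hc : ContinuousAt φ t) : deriv (deriv φ) t ≤ 0 := by
  by_contra! hpos
  have hmin := isLocalMin_of_deriv_deriv_pos hpos h.deriv_eq_zero hc
  have hconst : φ =ᶠ[𝓝 t] fun _ => φ t := by
    filter_upwards [h, hmin] with s h₁ h₂ using le_antisymm h₁ h₂
  have := hconst.deriv.deriv_eq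
  simp [this] at hpos

theorem ContDiffAt.deriv_deriv_comp_add_smul {E : Type*} [NormedAddCommGroup E] [NormedSpace ℝ E]
    {f : E → ℝ} {p : E} (hf : ContDiffAt ℝ 2 f p) (v : E) :
    deriv (deriv fun t : ℝ => f (p + t • v)) 0 = iteratedFDeriv ℝ 2 f p ![v, v] := by
  have hline (t : ℝ) : HasDerivAt (fun t : ℝ => p + t • v) v t := by
    simpa using ((hasDerivAt_id t).smul_const v).const_add p
  have hlim : Tendsto (fun t : ℝ => p + t • v) (𝓝 0) (𝓝 p) := by
    simpa using (hline 0).continuousAt.tendsto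
  have hfirst : deriv (fun t : ℝ => f (p + t • v)) =ᶠ[𝓝 0]
      fun t => fderiv ℝ f (p + t • v) v := by
    filter_upwards [hlim.eventually (hf.eventually (by simp))] with t ht
    exact ((ht.differentiableAt (by simp)).hasFDerivAt.comp_hasDerivAt t (hline t)).deriv
  have hsecond : DifferentiableAt ℝ (fderiv ℝ f) p :=
    (hf.fderiv_right (m := 1) (by norm_num)).differentiableAt (by simp)
  have happly : HasFDerivAt (fun y => fderiv ℝ f y v) ((fderiv ℝ (fderiv ℝ f) p).flip v) p := by
    simpa using hsecond.hasFDerivAt.clm_apply (hasFDerivAt_const v p)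
  rw [hfirst.deriv_eq, iteratedFDeriv_two_apply]
  exact (happly.comp_hasDerivAt_of_eq 0 (hline 0) (by simp)).deriv

theorem IsLocalMax.laplacian_nonpos {E : Type*} [NormedAddCommGroup E] [InnerProductSpace ℝ E]
    [FiniteDimensional ℝ E] {f : E → ℝ} {p : E} (h : IsLocalMax f p) (hf : ContDiffAt ℝ 2 f p) :
    Laplacian.laplacian f p ≤ 0 := by
  rw [laplacian_eq_iteratedFDeriv_stdOrthonormalBasis]
  refine Finset.sum_nonpos fun i _ => ?_
  rw [← hf.deriv_deriv_comp_add_smul]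
  set v := stdOrthonormalBasis ℝ E i
  have hcont : Continuous fun t : ℝ => p + t • v := by fun_prop
  have hlim : Tendsto (fun t : ℝ => p + t • v) (𝓝 0) (𝓝 p) := by
    simpa using hcont.tendsto 0
  refine IsLocalMax.deriv_deriv_nonpos ?_ ?_
  · filter_upwards [hlim.eventually h] with t ht
    simpa using ht
  · exact ContinuousAt.comp (f := fun t : ℝ => p + t • v) (by simpa using hf.continuousAt) hcont.continuousAt

/-- The Laplacian may be computed in any orthonormal basis, in particular in the image under `S` of
the standard one. -/
theorem LinearIsometryEquiv.laplacian_comp {E F : Type*} [NormedAddCommGroup E]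
    [InnerProductSpace ℝ E] [FiniteDimensional ℝ E] [NormedAddCommGroup F] [NormedSpace ℝ F]
    (S : E ≃ₗᵢ[ℝ] E) (f : E → F) (x : E) : Laplacian.laplacian (f ∘ S) x = Laplacian.laplacian f (S x) := by
  rw [laplacian_eq_iteratedFDeriv_orthonormalBasis (f ∘ S) (stdOrthonormalBasis ℝ E),
    laplacian_eq_iteratedFDeriv_orthonormalBasis f ((stdOrthonormalBasis ℝ E).map S)]
  refine Finset.sum_congr rfl fun i _ => ?_
  have := S.toContinuousLinearEquiv.iteratedFDerivWithin_comp_right f uniqueDiffOn_univ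
    (x := x) (Set.mem_univ _) 2
  rw [Set.preimage_univ, iteratedFDerivWithin_univ, iteratedFDerivWithin_univ] at this
  rw [show f ∘ S = f ∘ S.toContinuousLinearEquiv from rfl, this]
  simp only [ContinuousMultilinearMap.compContinuousLinearMap_apply]
  congr 1
  ext j
  fin_cases j <;> simp

theorem LinearIsometryEquiv.harmonicAt_comp_add {E F : Type*} [NormedAddCommGroup E]
    [InnerProductSpace ℝ E] [FiniteDimensional ℝ E] [NormedAddCommGroup F] [NormedSpace ℝ F]
    (S : E ≃ₗᵢ[ℝ] E) (c : E) {f : E → F} {x : E} (h : HarmonicAt f (S x + c)) :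
    HarmonicAt (fun y => f (S y + c)) x := by
  have hcont : Continuous fun y => S y + c := by fun_prop
  refine ⟨?_, ?_⟩
  · exact h.1.comp x (by fun_prop : ContDiffAt ℝ 2 (fun y => S y + c) x)
  · filter_upwards [hcont.continuousAt.eventually h.2] with y hy
    have htrans : Laplacian.laplacian (fun z => f (z + c)) (S y) = Laplacian.laplacian f (S y + c) := by
      simp [laplacian_eq_iteratedFDeriv_stdOrthonormalBasis, iteratedFDeriv_comp_add_right]
    exact (S.laplacian_comp (fun z => f (z + c)) y).trans (htrans.trans hy)

/-! ### Geometry of the crystal and the unit cell -/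

namespace ResonatorChain

@[simp] theorem e₁_zero : e₁ 0 = 1 := by simp [e₁]
@[simp] theorem e₁_one : e₁ 1 = 0 := by simp [e₁]
@[simp] theorem e₁_two : e₁ 2 = 0 := by simp [e₁]

@[simp] theorem axisDist_add_smul_e₁ (x : E3) (t : ℝ) : axisDist (x + t • e₁) = axisDist x := by
  simp [axisDist]

theorem continuous_axisDist : Continuous axisDist := by unfold axisDist; fun_prop

theorem sq_le_axisDist_sq (x : E3) : x 1 ^ 2 ≤ axisDist x ^ 2 := by
  rw [axisDist, Real.sq_sqrt (by positivity)]
  nlinarith [sq_nonneg (x 2)]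

theorem add_mem_crystal_iff {L : ℝ} {D : Fin 2 → Set E3} (x : E3) (m : ℤ) :
    x + ((m : ℝ) * L) • e₁ ∈ crystal L D ↔ x ∈ crystal L D := by
  constructor
  · rintro ⟨k, i, h⟩
    refine ⟨k - m, i, ?_⟩
    convert h using 1
    push_cast
    module
  · rintro ⟨k, i, h⟩
    refine ⟨k + m, i, ?_⟩
    convert h using 1
    push_cast
    module

theorem add_mem_closure_crystal_iff {L : ℝ} {D : Fin 2 → Set E3} (x : E3) (m : ℤ) :
    x + ((m : ℝ) * L) • e₁ ∈ closure (crystal L D) ↔ x ∈ closure (crystal L D) := by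
  have h : (Homeomorph.addRight (((m : ℝ) * L) • e₁)) ⁻¹' crystal L D = crystal L D := by
    ext y
    exact add_mem_crystal_iff y m
  conv_rhs => rw [← h, ← Homeomorph.preimage_closure]
  rfl

theorem isOpen_crystal {L : ℝ} {D : Fin 2 → Set E3} (hD : ∀ i, IsOpen (D i)) :
    IsOpen (crystal L D) := by
  have : crystal L D = ⋃ (m : ℤ) (i : Fin 2), (fun x => x - ((m : ℝ) * L) • e₁) ⁻¹' D i := by
    ext x
    simp [crystal]
  rw [this]
  exact isOpen_iUnion fun m => isOpen_iUnion fun i => (hD i).preimage (by fun_prop)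

/-- The translates of bounded resonators form a locally finite family, so the closure of their union
is the union of their closures. -/
theorem exists_mem_closure_of_mem_closure_crystal {L : ℝ} (hL : 0 < L) {D : Fin 2 → Set E3}
    (hD : ∀ i, Bornology.IsBounded (D i)) {x : E3} (hx : x ∈ closure (crystal L D)) :
    ∃ (m : ℤ) (i : Fin 2), x - ((m : ℝ) * L) • e₁ ∈ closure (D i) := by
  obtain ⟨B, hB⟩ : ∃ B : ℝ, ∀ i, ∀ y ∈ D i, |y 0| ≤ B := by
    obtain ⟨B, hB⟩ := (Bornology.isBounded_iUnion.2 hD).exists_norm_le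
    exact ⟨B, fun i y hy => (EuclideanSpace.norm_eq y ▸ Real.abs_le_sqrt (by
      simp only [Fin.sum_univ_three, Real.norm_eq_abs, sq_abs]
      nlinarith [sq_nonneg (y 1), sq_nonneg (y 2)])).trans (hB y (Set.mem_iUnion_of_mem i hy))⟩
  let h (p : ℤ × Fin 2) : E3 ≃ₜ E3 := Homeomorph.addRight (-(((p.1 : ℝ) * L) • e₁))
  have hcr : crystal L D = ⋃ p : ℤ × Fin 2, h p ⁻¹' D p.2 := by
    ext y
    simp [crystal, h, sub_eq_add_neg]
  have hfin : LocallyFinite fun p : ℤ × Fin 2 => h p ⁻¹' D p.2 := by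
    intro y
    refine ⟨{z | |z 0 - y 0| < 1}, ?_, ?_⟩
    · refine IsOpen.mem_nhds (isOpen_lt (by fun_prop) (by fun_prop)) ?_
      simp
    · refine ((Set.finite_Icc ⌊(y 0 - 1 - B) / L⌋ ⌈(y 0 + 1 + B) / L⌉).prod
        (Set.finite_univ (α := Fin 2))).subset ?_
      rintro ⟨m, i⟩ ⟨z, hz, hzy⟩
      have h₁ := hB i _ hz
      simp only [h, Homeomorph.coe_addRight, PiLp.add_apply, PiLp.neg_apply, PiLp.smul_apply,
        e₁_zero, smul_eq_mul, mul_one] at h₁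
      simp only [Set.mem_ofPred_eq] at hzy
      rw [abs_le] at h₁
      rw [abs_lt] at hzy
      refine ⟨⟨?_, ?_⟩, trivial⟩
      · have : (y 0 - 1 - B) / L ≤ m := by rw [div_le_iff₀ hL]; linarith
        exact Int.cast_le (R := ℝ).1 ((Int.floor_le _).trans this)
      · have : (m : ℝ) ≤ (y 0 + 1 + B) / L := by rw [le_div_iff₀ hL]; linarith
        exact Int.cast_le (R := ℝ).1 (this.trans (Int.le_ceil _))
  rw [hcr, hfin.closure_iUnion, Set.mem_iUnion] at hx
  obtain ⟨⟨m, i⟩, hp⟩ := hx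
  rw [← Homeomorph.preimage_closure] at hp
  exact ⟨m, i, by simpa [h, sub_eq_add_neg] using hp⟩

theorem exists_translate_mem_unitCell {L : ℝ} (hL : 0 < L) (x : E3) :
    ∃ m : ℤ, x + ((m : ℝ) * L) • e₁ ∈ unitCell L := by
  obtain ⟨m, hm, -⟩ := existsUnique_add_zsmul_mem_Ico hL (x 0) (-(L / 2))
  refine ⟨m, ?_⟩
  simp only [zsmul_eq_mul, Set.mem_Ico] at hm
  simp only [unitCell, Set.mem_ofPred_eq, PiLp.add_apply, PiLp.smul_apply, e₁_zero, smul_eq_mul,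
    mul_one, Set.mem_Icc]
  constructor <;> linarith

theorem isCompact_unitCell_inter {L : ℝ} {C : Set E3} (hC : IsOpen C) (R : ℝ) :
    IsCompact {x : E3 | x ∉ C ∧ x ∈ unitCell L ∧ axisDist x ≤ R} := by
  refine Metric.isCompact_of_isClosed_isBounded ?_ ?_
  · refine hC.isClosed_compl.inter (IsClosed.inter ?_ ?_)
    · exact isClosed_Icc.preimage (f := fun x : E3 => x 0) (by fun_prop)
    · exact isClosed_le continuous_axisDist continuous_const
  · refine isBounded_iff_forall_norm_le.2 ⟨Real.sqrt ((L / 2) ^ 2 + R ^ 2), ?_⟩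
    rintro x ⟨-, hx, hR⟩
    rw [EuclideanSpace.norm_eq]
    refine Real.sqrt_le_sqrt ?_
    simp only [Fin.sum_univ_three, Real.norm_eq_abs, sq_abs]
    have h₀ : x 0 ^ 2 ≤ (L / 2) ^ 2 := sq_le_sq' hx.1 hx.2
    have h₁ : axisDist x ^ 2 ≤ R ^ 2 := pow_le_pow_left₀ (Real.sqrt_nonneg _) hR 2
    rw [axisDist, Real.sq_sqrt (by positivity)] at h₁
    linarith

/-! ### Maximum principle and uniqueness -/

theorem laplacian_coord_sq (p : E3) :
    Laplacian.laplacian (fun x : E3 => x 1 ^ 2) p = 2 := by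
  have h₁ : fderiv ℝ (fun x : E3 => x 1 ^ 2) =
      fun x => (2 * x 1) • (EuclideanSpace.proj 1 : E3 →L[ℝ] ℝ) := by
    funext x
    have := ((EuclideanSpace.proj (𝕜 := ℝ) 1 : E3 →L[ℝ] ℝ).hasFDerivAt (x := x)).pow 2
    simpa using this.fderiv
  have h₂ : HasFDerivAt (fderiv ℝ (fun x : E3 => x 1 ^ 2))
      (((2 : ℝ) • (EuclideanSpace.proj 1 : E3 →L[ℝ] ℝ)).smulRight
        (EuclideanSpace.proj 1 : E3 →L[ℝ] ℝ)) p := by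
    rw [h₁]
    have h := (EuclideanSpace.proj (𝕜 := ℝ) 1 : E3 →L[ℝ] ℝ).hasFDerivAt (x := p)
    exact (h.const_mul 2).smul_const (EuclideanSpace.proj 1 : E3 →L[ℝ] ℝ)
  rw [laplacian_eq_iteratedFDeriv_orthonormalBasis _ (EuclideanSpace.basisFun (Fin 3) ℝ)]
  simp [iteratedFDeriv_two_apply, h₂.fderiv, Fin.sum_univ_three]

/-- `|W| + ε x₂²` has no local maximum at a point where `W` is harmonic and nonzero. -/
theorem not_isLocalMax_norm_add_sq {W : E3 → ℂ} {p : E3} (hW : HarmonicAt W p) (h0 : W p ≠ 0)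
    {ε : ℝ} (hε : 0 < ε) : ¬ IsLocalMax (fun x => ‖W x‖ + ε * x 1 ^ 2) p := by
  intro hmax
  -- `l` supports the norm at `W p`: `l ∘ W ≤ ‖W‖` with equality at `p`. So `l ∘ W + ε x₂²` inherits
  -- the local maximum, although its Laplacian there is `2ε > 0`.
  let l : ℂ →L[ℝ] ℝ := (‖W p‖⁻¹) • (innerSL ℝ (W p))
  have hlp : l (W p) = ‖W p‖ := by
    have : ‖W p‖ ≠ 0 := norm_ne_zero_iff.2 h0
    simp only [l, _root_.smul_apply, innerSL_apply_apply, smul_eq_mul,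
      real_inner_self_eq_norm_sq]
    field_simp
  have hle (z : ℂ) : l z ≤ ‖z‖ := by
    simp only [l, _root_.smul_apply, innerSL_apply_apply, smul_eq_mul]
    rw [inv_mul_le_iff₀ (norm_pos_iff.2 h0)]
    exact real_inner_le_norm _ _
  have hg := hW.comp_CLM l
  have hsq : ContDiffAt ℝ 2 (fun x : E3 => x 1 ^ 2) p := by fun_prop
  have hsq' : ContDiffAt ℝ 2 (ε • fun x : E3 => x 1 ^ 2) p := hsq.const_smul ε
  have hlap := IsLocalMax.laplacian_nonpos (f := l ∘ W + ε • fun x : E3 => x 1 ^ 2) (p := p) ?_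
    (hg.1.add hsq')
  · rw [hg.1.laplacian_add hsq', laplacian_smul ε hsq, laplacian_coord_sq,
      hg.2.eq_of_nhds] at hlap
    simp at hlap
    linarith
  · filter_upwards [hmax] with y hy
    simp only [Pi.add_apply, Function.comp_apply, Pi.smul_apply, smul_eq_mul, hlp]
    linarith [hle (W y)]

theorem norm_exp_phase (α L : ℝ) (m : ℤ) : ‖Complex.exp (Complex.I * α * m * L)‖ = 1 := by
  rw [show Complex.I * α * m * L = ((α * m * L : ℝ) : ℂ) * Complex.I by push_cast; ring]
  exact Complex.norm_exp_ofReal_mul_I _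

/-- Uniqueness of quasiperiodic potentials outside the crystal, by the maximum principle. -/
theorem IsPotential.unique {L α : ℝ} (hL : 0 < L) {D : Fin 2 → Set E3}
    (hopen : ∀ i, IsOpen (D i)) (hbdd : ∀ i, Bornology.IsBounded (D i)) {j : Fin 2}
    {V V' : E3 → ℂ} (hV : IsPotential L α D j V) (hV' : IsPotential L α D j V') {x : E3}
    (hx : x ∉ crystal L D) : V x = V' x := by
  by_contra hne
  let W : E3 → ℂ := V - V'
  have hWc : ContinuousOn W (crystal L D)ᶜ := hV.continuousOn.sub hV'.continuousOn
  have hWh : HarmonicOnNhd W (closure (crystal L D))ᶜ := hV.harmonic.sub hV'.harmonic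
  have hWq (y : E3) (hy : y ∉ crystal L D) (m : ℤ) :
      ‖W (y + ((m : ℝ) * L) • e₁)‖ = ‖W y‖ := by
    simp only [W, Pi.sub_apply]
    rw [hV.quasiperiodic y hy, hV'.quasiperiodic y hy, ← mul_sub, norm_mul, norm_exp_phase, one_mul]
  have hWb (y : E3) (hy : y ∉ crystal L D) (hy' : y ∈ closure (crystal L D)) : W y = 0 := by
    obtain ⟨m, i, hm⟩ := exists_mem_closure_of_mem_closure_crystal hL hbdd hy'
    have hfr : y - ((m : ℝ) * L) • e₁ ∈ frontier (D i) := by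
      rw [(hopen i).frontier_eq]
      exact ⟨hm, fun h => hy ⟨m, i, h⟩⟩
    have := hWq y hy (-m)
    rw [show y + (((-m : ℤ) : ℝ) * L) • e₁ = y - ((m : ℝ) * L) • e₁ by push_cast; module] at this
    simp only [W, Pi.sub_apply, hV.boundary i _ hfr, hV'.boundary i _ hfr, sub_self,
      norm_zero] at this
    exact norm_eq_zero.1 this.symm
  set M := ‖W x‖ with hM
  have hMpos : 0 < M := norm_pos_iff.2 (sub_ne_zero.2 hne)
  -- Beyond distance `R` the decay of both solutions forces `‖W‖ ≤ M / 2`.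
  obtain ⟨R, hRpos, hxR, hWR⟩ : ∃ R : ℝ, 0 < R ∧ axisDist x ≤ R ∧
      ∀ y ∉ crystal L D, R ≤ axisDist y → ‖W y‖ ≤ M / 2 := by
    obtain ⟨K₁, R₁, hR₁, h₁⟩ := hV.decay
    obtain ⟨K₂, R₂, hR₂, h₂⟩ := hV'.decay
    refine ⟨max (max R₁ R₂) (max (axisDist x) ((K₁ + K₂) / (M / 2))), ?_, ?_, ?_⟩
    · exact lt_max_of_lt_left (lt_max_of_lt_left hR₁)
    · exact (le_max_left _ _).trans (le_max_right _ _)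
    · intro y hy hyR
      simp only [max_le_iff] at hyR
      have hpos : 0 < axisDist y := hR₁.trans_le hyR.1.1
      calc ‖W y‖ ≤ ‖V y‖ + ‖V' y‖ := norm_sub_le _ _
        _ ≤ K₁ / axisDist y + K₂ / axisDist y :=
          add_le_add (h₁ y hy hyR.1.1) (h₂ y hy hyR.1.2)
        _ = (K₁ + K₂) / axisDist y := by ring
        _ ≤ M / 2 := by
          rw [div_le_iff₀ hpos, mul_comm, ← div_le_iff₀ (by positivity)]
          exact hyR.2.2
  -- With this `ε` the perturbation is at most `M / 4` for `axisDist ≤ R`. A maximiser then has `‖W‖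
  -- ≥ 3M/4`, which keeps it off the outer wall and off the boundary of the crystal.
  set ε := M / (4 * R ^ 2) with hε
  have hεpos : 0 < ε := by positivity
  have hεR : ε * R ^ 2 = M / 4 := by rw [hε]; field_simp
  let f : E3 → ℝ := fun y => ‖W y‖ + ε * y 1 ^ 2
  have hfq (y : E3) (hy : y ∉ crystal L D) (m : ℤ) : f (y + ((m : ℝ) * L) • e₁) = f y := by
    simp [f, hWq y hy m]
  set Q : Set E3 := {y | y ∉ crystal L D ∧ y ∈ unitCell L ∧ axisDist y ≤ R}
  have hQ : IsCompact Q := isCompact_unitCell_inter (isOpen_crystal hopen) R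
  -- The maximiser over `Q` may lie on a face of the cell; periodicity of `f` extends its maximality
  -- to the full tube, hence to a neighbourhood.
  have htrans (y : E3) (hy : y ∉ crystal L D) (hyR : axisDist y ≤ R) :
      ∃ z ∈ Q, f z = f y := by
    obtain ⟨m, hm⟩ := exists_translate_mem_unitCell hL y
    exact ⟨y + ((m : ℝ) * L) • e₁, ⟨by rwa [add_mem_crystal_iff], hm, by simpa using hyR⟩,
      hfq y hy m⟩
  obtain ⟨x', hx'Q, hx'⟩ := htrans x hx hxR
  have hfc : ContinuousOn f Q := by
    have : ContinuousOn W Q := hWc.mono fun y hy => hy.1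
    fun_prop
  obtain ⟨p, hpQ, hp⟩ := hQ.exists_isMaxOn ⟨x', hx'Q⟩ hfc
  have hpM : M ≤ f p := by
    have h₁ : f x' ≤ f p := hp hx'Q
    have h₂ : M ≤ f x := by
      simp only [f, ← hM]
      have : 0 ≤ ε * x 1 ^ 2 := by positivity
      linarith
    linarith
  have hpW : M / 2 < ‖W p‖ := by
    have h₁ : p 1 ^ 2 ≤ R ^ 2 :=
      (sq_le_axisDist_sq p).trans (pow_le_pow_left₀ (Real.sqrt_nonneg _) hpQ.2.2 2)
    have h₂ := mul_le_mul_of_nonneg_left h₁ hεpos.le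
    simp only [f] at hpM
    linarith
  have hW0 : W p ≠ 0 := by
    rw [← norm_pos_iff]
    linarith
  have hpR : axisDist p < R := by
    by_contra! h
    linarith [hWR p hpQ.1 h]
  have hpcl : p ∈ (closure (crystal L D))ᶜ := fun h => hW0 (hWb p hpQ.1 h)
  refine not_isLocalMax_norm_add_sq (hWh p hpcl) hW0 hεpos ?_
  filter_upwards [isClosed_closure.isOpen_compl.mem_nhds hpcl,
    (isOpen_lt continuous_axisDist continuous_const).mem_nhds hpR] with y hy hyR
  obtain ⟨z, hzQ, hz⟩ := htrans y (fun h => hy (subset_closure h)) (le_of_lt hyR)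
  exact hz.symm.le.trans (hp hzQ)

end ResonatorChain

/-! ### Reflections and reflected dimers -/

open MeasureTheory

noncomputable section

namespace ResonatorChain

/-- The linear part of the reflections in the planes orthogonal to the axis. -/
def axisFlip : E3 ≃ₗᵢ[ℝ] E3 :=
  LinearIsometryEquiv.piLpCongrRight 2
    fun i => if i = 0 then LinearIsometryEquiv.neg ℝ else LinearIsometryEquiv.refl ℝ ℝ

theorem planeReflection_eq (c : ℝ) (x : E3) :
    planeReflection c x = axisFlip x + (2 * c) • e₁ := by
  ext i
  fin_cases i <;> simp [planeReflection, axisFlip]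
  ring

theorem axisFlip_single (k : Fin 3) :
    axisFlip (EuclideanSpace.single k 1) =
      (if k = 0 then (-1 : ℝ) else 1) • EuclideanSpace.single k 1 := by
  ext i
  fin_cases k <;> fin_cases i <;> simp [axisFlip]

theorem planeReflection_involutive (c : ℝ) : Function.Involutive (planeReflection c) := by
  intro x
  simp only [planeReflection, PiLp.add_apply, PiLp.smul_apply, e₁_zero, smul_eq_mul]
  module

theorem continuous_planeReflection (c : ℝ) : Continuous (planeReflection c) := by
  unfold planeReflection
  fun_prop

theorem planeReflection_add_smul (c t : ℝ) (x : E3) :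
    planeReflection c (x + t • e₁) = planeReflection c x - t • e₁ := by
  simp only [planeReflection, PiLp.add_apply, PiLp.smul_apply, e₁_zero, smul_eq_mul]
  module

theorem planeReflection_sub_smul (c t : ℝ) (x : E3) :
    planeReflection c (x - t • e₁) = planeReflection c x + t • e₁ := by
  rw [sub_eq_add_neg, ← neg_smul, planeReflection_add_smul, neg_smul, sub_neg_eq_add]

theorem axisDist_planeReflection (c : ℝ) (x : E3) :
    axisDist (planeReflection c x) = axisDist x := by
  simp [planeReflection]

theorem hasFDerivAt_planeReflection (c : ℝ) (x : E3) :
    HasFDerivAt (planeReflection c) (axisFlip.toContinuousLinearEquiv : E3 →L[ℝ] E3) x := by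
  rw [funext (planeReflection_eq c)]
  exact (axisFlip.toContinuousLinearEquiv : E3 →L[ℝ] E3).hasFDerivAt.add_const _

theorem measurePreserving_planeReflection (c : ℝ) :
    MeasurePreserving (planeReflection c) (volume : Measure E3) volume := by
  rw [funext (planeReflection_eq c)]
  exact (measurePreserving_add_right volume ((2 * c) • e₁)).comp axisFlip.measurePreserving

/-- Reflection in a plane orthogonal to the axis, as a homeomorphism. -/
def planeReflectionHomeomorph (c : ℝ) : E3 ≃ₜ E3 where
  toEquiv := (planeReflection_involutive c).toPerm
  continuous_toFun := continuous_planeReflection c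
  continuous_invFun := continuous_planeReflection c

@[simp] theorem coe_planeReflectionHomeomorph (c : ℝ) :
    ⇑(planeReflectionHomeomorph c) = planeReflection c := rfl

/-- `D'` is the reflection of the dimer `D` in the plane `{c} × ℝ²`, up to a translation of the
resonator `D i` by `n i` cells. -/
def IsReflectedDimer (L c : ℝ) (n : Fin 2 → ℤ) (D D' : Fin 2 → Set E3) : Prop :=
  ∀ i x, x ∈ D' i ↔ planeReflection c x - ((n i : ℝ) * L) • e₁ ∈ D i

namespace IsReflectedDimer

variable {L c : ℝ} {n : Fin 2 → ℤ} {D D' : Fin 2 → Set E3}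

/-- Reflection reverses axial translations, so `x ↦ planeReflection c x - (n i * L) • e₁` is an
involution. -/
theorem symm (h : IsReflectedDimer L c n D D') : IsReflectedDimer L c n D' D := by
  intro i x
  rw [h i, planeReflection_sub_smul, planeReflection_involutive c x, add_sub_cancel_right]

/-- The homeomorphism of space that maps the resonator `D' i` to `D i`. -/
def homeomorph (L c : ℝ) (n : ℤ) : E3 ≃ₜ E3 :=
  (planeReflectionHomeomorph c).trans (Homeomorph.addRight (-(((n : ℝ) * L) • e₁)))

theorem homeomorph_apply (L c : ℝ) (n : ℤ) (x : E3) :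
    homeomorph L c n x = planeReflection c x - ((n : ℝ) * L) • e₁ := by
  simp [homeomorph, sub_eq_add_neg]

theorem eq_preimage (h : IsReflectedDimer L c n D D') (i : Fin 2) :
    D' i = homeomorph L c (n i) ⁻¹' D i := by
  ext x
  rw [Set.mem_preimage, homeomorph_apply, h i]

theorem isOpen (h : IsReflectedDimer L c n D D') (hD : ∀ i, IsOpen (D i)) (i : Fin 2) :
    IsOpen (D' i) := by
  rw [h.eq_preimage i]
  exact (hD i).preimage (homeomorph L c (n i)).continuous

theorem isBounded (h : IsReflectedDimer L c n D D') (hD : ∀ i, Bornology.IsBounded (D i))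
    (i : Fin 2) : Bornology.IsBounded (D' i) := by
  have hK := (hD i).isCompact_closure.image (homeomorph L c (n i)).symm.continuous
  refine hK.isBounded.subset ?_
  rw [h.eq_preimage i, ← Homeomorph.image_symm]
  exact Set.image_mono subset_closure

theorem frontier_iff (h : IsReflectedDimer L c n D D') (i : Fin 2) (x : E3) :
    x ∈ frontier (D' i) ↔ planeReflection c x - ((n i : ℝ) * L) • e₁ ∈ frontier (D i) := by
  rw [h.eq_preimage i, ← Homeomorph.preimage_frontier, Set.mem_preimage, homeomorph_apply]

theorem mem_crystal_iff (h : IsReflectedDimer L c n D D') (x : E3) :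
    planeReflection c x ∈ crystal L D ↔ x ∈ crystal L D' := by
  constructor
  · rintro ⟨m, i, hm⟩
    refine ⟨n i - m, i, ?_⟩
    rw [h i, planeReflection_sub_smul]
    convert hm using 1
    push_cast
    module
  · rintro ⟨m, i, hm⟩
    rw [h i, planeReflection_sub_smul] at hm
    refine ⟨n i - m, i, ?_⟩
    convert hm using 1
    push_cast
    module

theorem mem_closure_crystal_iff (h : IsReflectedDimer L c n D D') (x : E3) :
    planeReflection c x ∈ closure (crystal L D) ↔ x ∈ closure (crystal L D') := by
  have : crystal L D' = planeReflectionHomeomorph c ⁻¹' crystal L D := by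
    ext y
    exact (h.mem_crystal_iff y).symm
  rw [this, ← Homeomorph.preimage_closure]
  rfl

theorem frontier_disjoint (h : IsReflectedDimer L c n D D')
    (hD : ∀ i, ∀ x ∈ frontier (D i), x ∉ crystal L D) (i : Fin 2) (x : E3)
    (hx : x ∈ frontier (D' i)) : x ∉ crystal L D' := by
  rw [h.frontier_iff] at hx
  rw [← h.mem_crystal_iff, ← sub_add_cancel (planeReflection c x) (((n i : ℝ) * L) • e₁),
    add_mem_crystal_iff]
  exact hD i _ hx

end IsReflectedDimer

/-! ### Reflected potentials and their energy densities -/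

theorem conj_phase (α L : ℝ) (m : ℤ) :
    starRingEnd ℂ (Complex.exp (Complex.I * α * m * L)) =
      Complex.exp (Complex.I * α * (-m : ℤ) * L) := by
  rw [← Complex.exp_conj]
  simp

theorem phase_mul_conj_phase (α L : ℝ) (m : ℤ) :
    Complex.exp (Complex.I * α * m * L) *
      starRingEnd ℂ (Complex.exp (Complex.I * α * m * L)) = 1 := by
  rw [conj_phase, ← Complex.exp_add]
  simp

/-- The real-linear map `z ↦ a * conj z`. -/
def mulConj (a : ℂ) : ℂ →L[ℝ] ℂ :=
  (ContinuousLinearMap.mul ℝ ℂ a).comp (Complex.conjCLE : ℂ →L[ℝ] ℂ)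

@[simp] theorem mulConj_apply (a z : ℂ) : mulConj a z = a * starRingEnd ℂ z := by
  simp [mulConj]

/-- Conjugation undoes the sign change of `α` caused by the reflection. On `∂D' j` the reflected
point is a boundary point of `D j` shifted by `n j` cells, where `V` equals the phase; the prefactor
restores the value `1`. -/
theorem IsPotential.reflect {L c α : ℝ} {n : Fin 2 → ℤ} {D D' : Fin 2 → Set E3}
    (h : IsReflectedDimer L c n D D') (hD : ∀ i, ∀ x ∈ frontier (D i), x ∉ crystal L D)
    {j : Fin 2} {V : E3 → ℂ} (hV : IsPotential L α D j V) :
    IsPotential L α D' j fun x =>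
      mulConj (Complex.exp (Complex.I * α * n j * L)) (V (planeReflection c x)) where
  continuousOn := by
    refine (mulConj _).continuous.comp_continuousOn
      (hV.continuousOn.comp (continuous_planeReflection c).continuousOn ?_)
    intro x hx hmem
    exact hx ((h.mem_crystal_iff x).1 hmem)
  harmonic := by
    intro x hx
    have hx' : planeReflection c x ∈ (closure (crystal L D))ᶜ := fun hmem =>
      hx ((h.mem_closure_crystal_iff x).1 hmem)
    have hharm := hV.harmonic _ hx'
    simp only [planeReflection_eq] at hharm ⊢
    exact (axisFlip.harmonicAt_comp_add _ hharm).comp_CLM (mulConj _)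
  boundary := by
    intro i x hx
    rw [h.frontier_iff] at hx
    have hq := hV.quasiperiodic _ (hD i _ hx) (n i)
    rw [sub_add_cancel, hV.boundary i _ hx] at hq
    rw [mulConj_apply, hq]
    split_ifs with hij
    · subst hij
      simpa using phase_mul_conj_phase α L (n i)
    · simp
  quasiperiodic := by
    intro x hx m
    rw [← h.mem_crystal_iff] at hx
    have hq := hV.quasiperiodic _ hx (-m)
    rw [show planeReflection c x + (((-m : ℤ) : ℝ) * L) • e₁ =
      planeReflection c (x + ((m : ℝ) * L) • e₁) by
        rw [planeReflection_add_smul]; push_cast; module] at hq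
    rw [mulConj_apply, mulConj_apply, hq, map_mul, conj_phase, neg_neg]
    ring
  decay := by
    obtain ⟨K, R, hR, hK⟩ := hV.decay
    refine ⟨K, R, hR, fun x hx hxR => ?_⟩
    have := hK (planeReflection c x) (by rwa [h.mem_crystal_iff])
      (by rwa [axisDist_planeReflection])
    rw [axisDist_planeReflection] at this
    rwa [mulConj_apply, norm_mul, norm_exp_phase, one_mul, RCLike.norm_conj]

theorem isPotential_potential {L α : ℝ} {D : Fin 2 → Set E3} {j : Fin 2}
    (h : ∃ V, IsPotential L α D j V) : IsPotential L α D j (potential L α D j) := by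
  rw [potential, dif_pos h]
  exact h.choose_spec

theorem potential_of_not_exists {L α : ℝ} {D : Fin 2 → Set E3} {j : Fin 2}
    (h : ¬ ∃ V, IsPotential L α D j V) : potential L α D j = 0 := by
  rw [potential, dif_neg h]

/-- Uniqueness makes the arbitrary choice in `potential` harmless. Existence passes both ways by
`symm`, so without a solution both sides are the default `0`. -/
theorem potential_reflect {L c α : ℝ} (hL : 0 < L) {n : Fin 2 → ℤ} {D D' : Fin 2 → Set E3}
    (h : IsReflectedDimer L c n D D') (hopen : ∀ i, IsOpen (D i))
    (hbdd : ∀ i, Bornology.IsBounded (D i)) (hD : ∀ i, ∀ x ∈ frontier (D i), x ∉ crystal L D)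
    (j : Fin 2) {x : E3} (hx : x ∉ crystal L D') :
    potential L α D' j x = mulConj (Complex.exp (Complex.I * α * n j * L))
      (potential L α D j (planeReflection c x)) := by
  by_cases hex : ∃ V, IsPotential L α D j V
  · have hV := (isPotential_potential hex).reflect h hD
    exact (isPotential_potential ⟨_, hV⟩).unique hL (h.isOpen hopen) (h.isBounded hbdd) hV hx
  · have hex' : ¬ ∃ V, IsPotential L α D' j V := fun ⟨V, hV⟩ =>
      hex ⟨_, hV.reflect h.symm (h.frontier_disjoint hD)⟩
    simp [potential_of_not_exists hex, potential_of_not_exists hex']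

theorem differentiableAt_potential {L α : ℝ} {D : Fin 2 → Set E3} (j : Fin 2) {x : E3}
    (hx : x ∉ closure (crystal L D)) : DifferentiableAt ℝ (potential L α D j) x := by
  by_cases hex : ∃ V, IsPotential L α D j V
  · exact ((isPotential_potential hex).harmonic x hx).1.differentiableAt (by simp)
  · rw [potential_of_not_exists hex]
    exact differentiableAt_const 0

theorem potential_quasiperiodic {L α : ℝ} {D : Fin 2 → Set E3} (j : Fin 2) {x : E3}
    (hx : x ∉ crystal L D) (m : ℤ) : potential L α D j (x + ((m : ℝ) * L) • e₁) =
      Complex.exp (Complex.I * α * m * L) * potential L α D j x := by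
  by_cases hex : ∃ V, IsPotential L α D j V
  · exact (isPotential_potential hex).quasiperiodic x hx m
  · simp [potential_of_not_exists hex]

theorem eventually_notMem_of_notMem_closure {C : Set E3} {x : E3} (hx : x ∉ closure C) :
    ∀ᶠ y in 𝓝 x, y ∉ C := by
  filter_upwards [isClosed_closure.isOpen_compl.mem_nhds hx] with y hy h
  exact hy (subset_closure h)

theorem partialDeriv_potential_reflect {L c α : ℝ} (hL : 0 < L) {n : Fin 2 → ℤ}
    {D D' : Fin 2 → Set E3} (h : IsReflectedDimer L c n D D') (hopen : ∀ i, IsOpen (D i))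
    (hbdd : ∀ i, Bornology.IsBounded (D i)) (hD : ∀ i, ∀ x ∈ frontier (D i), x ∉ crystal L D)
    (j : Fin 2) (k : Fin 3) {x : E3} (hx : x ∉ closure (crystal L D')) :
    partialDeriv k (potential L α D' j) x = mulConj (Complex.exp (Complex.I * α * n j * L))
      ((if k = 0 then (-1 : ℝ) else 1) •
        partialDeriv k (potential L α D j) (planeReflection c x)) := by
  have heq : potential L α D' j =ᶠ[𝓝 x] fun y =>
      mulConj (Complex.exp (Complex.I * α * n j * L))
        (potential L α D j (planeReflection c y)) := by
    filter_upwards [eventually_notMem_of_notMem_closure hx] with y hy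
    exact potential_reflect hL h hopen hbdd hD j hy
  have hx' : planeReflection c x ∉ closure (crystal L D) := by rwa [h.mem_closure_crystal_iff]
  have hd := (mulConj (Complex.exp (Complex.I * α * n j * L))).hasFDerivAt.comp x
    ((differentiableAt_potential (α := α) j hx').hasFDerivAt.comp x
      (hasFDerivAt_planeReflection c x))
  rw [partialDeriv, heq.fderiv_eq]
  refine (congrArg (fun l : E3 →L[ℝ] ℂ => l (EuclideanSpace.single k 1)) hd.fderiv).trans ?_
  simp only [ContinuousLinearMap.comp_apply]
  congr 1
  refine (congrArg _ (axisFlip_single k)).trans ?_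
  rw [map_smul]
  rfl

theorem partialDeriv_potential_quasiperiodic {L α : ℝ} {D : Fin 2 → Set E3} (j : Fin 2)
    (k : Fin 3) {x : E3} (hx : x ∉ closure (crystal L D)) (m : ℤ) :
    partialDeriv k (potential L α D j) (x + ((m : ℝ) * L) • e₁) =
      Complex.exp (Complex.I * α * m * L) * partialDeriv k (potential L α D j) x := by
  have heq : (fun y => potential L α D j (y + ((m : ℝ) * L) • e₁)) =ᶠ[𝓝 x] fun y =>
      Complex.exp (Complex.I * α * m * L) * potential L α D j y := by
    filter_upwards [eventually_notMem_of_notMem_closure hx] with y hy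
    exact potential_quasiperiodic j hy m
  have := heq.fderiv_eq (𝕜 := ℝ)
  rw [fderiv_comp_add_right, fderiv_const_mul (differentiableAt_potential j hx)] at this
  rw [partialDeriv, this]
  rfl

/-- The density `conj (∇V_i^α) · ∇V_j^α` of the capacitance coefficient `C_{ij}^α`. -/
def capacitanceDensity (L α : ℝ) (D : Fin 2 → Set E3) (i j : Fin 2) (x : E3) : ℂ :=
  ∑ k : Fin 3, starRingEnd ℂ (partialDeriv k (potential L α D i) x) *
    partialDeriv k (potential L α D j) x

theorem capacitanceDensity_periodic {L α : ℝ} {D : Fin 2 → Set E3} (i j : Fin 2) {x : E3}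
    (hx : x ∉ closure (crystal L D)) (m : ℤ) :
    capacitanceDensity L α D i j (x + ((m : ℝ) * L) • e₁) = capacitanceDensity L α D i j x := by
  refine Finset.sum_congr rfl fun k _ => ?_
  rw [partialDeriv_potential_quasiperiodic i k hx, partialDeriv_potential_quasiperiodic j k hx,
    map_mul, mul_mul_mul_comm, mul_comm (starRingEnd ℂ _), phase_mul_conj_phase, one_mul]

theorem capacitanceDensity_reflect {L c α : ℝ} (hL : 0 < L) {n : Fin 2 → ℤ}
    {D D' : Fin 2 → Set E3} (h : IsReflectedDimer L c n D D') (hopen : ∀ i, IsOpen (D i))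
    (hbdd : ∀ i, Bornology.IsBounded (D i)) (hD : ∀ i, ∀ x ∈ frontier (D i), x ∉ crystal L D)
    (i j : Fin 2) {x : E3} (hx : x ∉ closure (crystal L D')) :
    capacitanceDensity L α D' i j x =
      starRingEnd ℂ (Complex.exp (Complex.I * α * n i * L)) *
        Complex.exp (Complex.I * α * n j * L) *
        starRingEnd ℂ (capacitanceDensity L α D i j (planeReflection c x)) := by
  rw [capacitanceDensity, capacitanceDensity, map_sum, Finset.mul_sum]
  refine Finset.sum_congr rfl fun k _ => ?_
  rw [partialDeriv_potential_reflect hL h hopen hbdd hD i k hx,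
    partialDeriv_potential_reflect hL h hopen hbdd hD j k hx]
  -- The sign of the axial derivative occurs twice in the product and cancels.
  split_ifs <;> simp <;> ring

/-! ### Change of fundamental cell and reflection of the capacitance -/

/-- The slab `[t, t + L] × ℝ²`. -/
def slab (L t : ℝ) : Set E3 := {x | x 0 ∈ Set.Icc t (t + L)}

theorem isAddFundamentalDomain_slab {L : ℝ} (hL : 0 < L) (t : ℝ) :
    IsAddFundamentalDomain (AddSubgroup.zmultiples (L • e₁))
      {x : E3 | x 0 ∈ Set.Ioc t (t + L)} := by
  refine IsAddFundamentalDomain.mk'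
    (measurableSet_Ioc.preimage (by fun_prop : Measurable fun x : E3 => x 0)).nullMeasurableSet
    fun x => ?_
  obtain ⟨m, hm, huniq⟩ := existsUnique_add_zsmul_mem_Ioc hL (x 0) t
  have hcoord (k : ℤ) : (k • (L • e₁) + x) 0 = x 0 + k • L := by
    simp [add_comm]
  refine ⟨⟨m • (L • e₁), m, rfl⟩, ?_, ?_⟩
  · change (m • (L • e₁) + x) 0 ∈ Set.Ioc t (t + L)
    rwa [hcoord]
  · rintro ⟨_, k, rfl⟩ hk
    change (k • (L • e₁) + x) 0 ∈ Set.Ioc t (t + L) at hk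
    rw [hcoord] at hk
    exact Subtype.ext (congrArg (· • (L • e₁)) (huniq k hk))

theorem slab_ae_eq (L t : ℝ) :
    slab L t =ᵐ[volume] {x : E3 | x 0 ∈ Set.Ioc t (t + L)} := by
  have hplane : volume {x : E3 | x 0 = t} = 0 := by
    have hmeas : MeasurableSet {f : Fin 3 → ℝ | f 0 = t} :=
      (measurableSet_singleton t).preimage (measurable_pi_apply 0)
    have := (EuclideanSpace.volume_preserving_symm_measurableEquiv_toLp (Fin 3)).measure_preimage
      hmeas.nullMeasurableSet
    exact this.trans (Measure.pi_hyperplane (fun _ : Fin 3 => (volume : Measure ℝ)) 0 t)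
  have hae : ∀ᵐ x : E3, x 0 ≠ t := by simpa [ae_iff] using hplane
  filter_upwards [hae] with x hx
  refine propext ⟨fun h => ⟨lt_of_le_of_ne h.1 (Ne.symm hx), h.2⟩, fun h => ⟨h.1.le, h.2⟩⟩

/-- Up to null faces, both slabs are fundamental domains for translation by `L • e₁`. The indicator
of `Cᶜ` is needed because `f` is periodic only off `C`. -/
theorem setIntegral_slab_diff_eq {L : ℝ} (hL : 0 < L) (s t : ℝ) {C : Set E3} (hC : IsClosed C)
    (hCper : ∀ (x : E3) (m : ℤ), x + ((m : ℝ) * L) • e₁ ∈ C ↔ x ∈ C) {f : E3 → ℂ}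
    (hf : ∀ x ∉ C, ∀ m : ℤ, f (x + ((m : ℝ) * L) • e₁) = f x) :
    ∫ x in slab L s \ C, f x = ∫ x in slab L t \ C, f x := by
  simp only [Set.sdiff_eq]
  rw [← setIntegral_indicator hC.measurableSet.compl, ← setIntegral_indicator
    hC.measurableSet.compl, setIntegral_congr_set (slab_ae_eq L s),
    setIntegral_congr_set (slab_ae_eq L t)]
  refine (isAddFundamentalDomain_slab hL s).setIntegral_eq (isAddFundamentalDomain_slab hL t) ?_
  rintro ⟨_, m, rfl⟩ x
  have hx : (⟨m • (L • e₁), m, rfl⟩ : AddSubgroup.zmultiples (L • e₁)) +ᵥ x =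
      x + ((m : ℝ) * L) • e₁ := by
    change m • (L • e₁) + x = _
    module
  change Set.indicator Cᶜ f ((⟨m • (L • e₁), m, rfl⟩ : AddSubgroup.zmultiples (L • e₁)) +ᵥ x) = _
  rw [hx]
  by_cases hxC : x ∈ C
  · rw [Set.indicator_of_notMem (by simpa using (hCper x m).2 hxC),
      Set.indicator_of_notMem (by simpa using hxC)]
  · rw [Set.indicator_of_mem (by simpa [hCper] using hxC), Set.indicator_of_mem (by simpa using hxC),
      hf x hxC]

theorem unitCell_eq_slab (L : ℝ) : unitCell L = slab L (-(L / 2)) := by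
  ext x
  simp only [unitCell, slab, show -(L / 2) + L = L / 2 by ring]

theorem planeReflection_mem_slab_iff (L c : ℝ) (x : E3) :
    planeReflection c x ∈ slab L (2 * c - L / 2) ↔ x ∈ unitCell L := by
  simp only [slab, unitCell, planeReflection, Set.mem_ofPred_eq, PiLp.add_apply, PiLp.smul_apply,
    e₁_zero, smul_eq_mul, mul_one, Set.mem_Icc]
  constructor <;> rintro ⟨h₁, h₂⟩ <;> constructor <;> linarith

/-- The capacitance matrices of a dimer and of its reflection agree up to conjugation and the
phases of the translations involved. -/
theorem capacitance_reflect {L c α : ℝ} (hL : 0 < L) {n : Fin 2 → ℤ} {D D' : Fin 2 → Set E3}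
    (h : IsReflectedDimer L c n D D') (hopen : ∀ i, IsOpen (D i))
    (hbdd : ∀ i, Bornology.IsBounded (D i)) (hD : ∀ i, ∀ x ∈ frontier (D i), x ∉ crystal L D)
    (i j : Fin 2) :
    capacitance L α D' i j =
      starRingEnd ℂ (Complex.exp (Complex.I * α * n i * L)) *
        Complex.exp (Complex.I * α * n j * L) * starRingEnd ℂ (capacitance L α D i j) := by
  have hpre : unitCell L \ closure (crystal L D') =
      planeReflection c ⁻¹' (slab L (2 * c - L / 2) \ closure (crystal L D)) := by
    ext x
    simp only [Set.mem_sdiff, Set.mem_preimage, planeReflection_mem_slab_iff,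
      h.mem_closure_crystal_iff]
  have hmeas : MeasurableSet (unitCell L \ closure (crystal L D')) :=
    (measurableSet_Icc.preimage (by fun_prop : Measurable fun x : E3 => x 0)).diff
      isClosed_closure.measurableSet
  calc capacitance L α D' i j
      = ∫ x in unitCell L \ closure (crystal L D'), capacitanceDensity L α D' i j x := rfl
    _ = ∫ x in unitCell L \ closure (crystal L D'),
          starRingEnd ℂ (Complex.exp (Complex.I * α * n i * L)) *
            Complex.exp (Complex.I * α * n j * L) *
            starRingEnd ℂ (capacitanceDensity L α D i j (planeReflection c x)) :=
        setIntegral_congr_fun hmeas fun x hx =>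
          capacitanceDensity_reflect hL h hopen hbdd hD i j hx.2
    _ = starRingEnd ℂ (Complex.exp (Complex.I * α * n i * L)) *
          Complex.exp (Complex.I * α * n j * L) *
          starRingEnd ℂ (∫ x in slab L (2 * c - L / 2) \ closure (crystal L D),
            capacitanceDensity L α D i j x) := by
        rw [integral_const_mul, integral_conj, hpre]
        congr 2
        exact (measurePreserving_planeReflection c).setIntegral_preimage_emb
          (planeReflectionHomeomorph c).measurableEmbedding _ _
    _ = _ := by
        rw [setIntegral_slab_diff_eq hL (2 * c - L / 2) (-(L / 2)) isClosed_closure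
          (fun x m => add_mem_closure_crystal_iff x m)
          (fun x hx m => capacitanceDensity_periodic i j hx m), ← unitCell_eq_slab]
        rfl

/-! ### Reality at `α = π/L` -/

theorem IsPotential.conj {L : ℝ} (hL : L ≠ 0) {D : Fin 2 → Set E3} {j : Fin 2} {V : E3 → ℂ}
    (hV : IsPotential L (Real.pi / L) D j V) :
    IsPotential L (Real.pi / L) D j fun x => starRingEnd ℂ (V x) where
  continuousOn := Complex.continuous_conj.comp_continuousOn hV.continuousOn
  harmonic := hV.harmonic.comp_CLM (Complex.conjCLE : ℂ →L[ℝ] ℂ)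
  boundary := by
    intro i x hx
    rw [hV.boundary i x hx]
    split_ifs <;> simp
  quasiperiodic := by
    intro x hx m
    rw [hV.quasiperiodic x hx, map_mul, conj_phase]
    congr 1
    rw [Complex.exp_eq_exp_iff_exists_int]
    -- The exponents `-iπm` and `iπm` differ by `-m` times `2πi`.
    refine ⟨-m, ?_⟩
    have : (L : ℂ) ≠ 0 := Complex.ofReal_ne_zero.2 hL
    push_cast
    field_simp
    ring
  decay := by simpa using hV.decay

theorem conj_capacitance_pi_div {L : ℝ} (hL : 0 < L) {D : Fin 2 → Set E3}
    (hopen : ∀ i, IsOpen (D i)) (hbdd : ∀ i, Bornology.IsBounded (D i)) (i j : Fin 2) :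
    starRingEnd ℂ (capacitance L (Real.pi / L) D i j) = capacitance L (Real.pi / L) D i j := by
  have hreal (j : Fin 2) {x : E3} (hx : x ∉ crystal L D) :
      starRingEnd ℂ (potential L (Real.pi / L) D j x) = potential L (Real.pi / L) D j x := by
    by_cases hex : ∃ V, IsPotential L (Real.pi / L) D j V
    · have hV := isPotential_potential hex
      exact (hV.conj hL.ne').unique hL hopen hbdd hV hx
    · simp [potential_of_not_exists hex]
  have hderiv (j : Fin 2) (k : Fin 3) {x : E3} (hx : x ∉ closure (crystal L D)) :
      starRingEnd ℂ (partialDeriv k (potential L (Real.pi / L) D j) x) =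
        partialDeriv k (potential L (Real.pi / L) D j) x := by
    have heq : (fun y => Complex.conjCLE (potential L (Real.pi / L) D j y)) =ᶠ[𝓝 x]
        potential L (Real.pi / L) D j := by
      filter_upwards [eventually_notMem_of_notMem_closure hx] with y hy
      exact hreal j hy
    have hd := (Complex.conjCLE : ℂ →L[ℝ] ℂ).hasFDerivAt.comp x
      (differentiableAt_potential (α := Real.pi / L) j hx).hasFDerivAt
    have := hd.fderiv.symm.trans heq.fderiv_eq
    exact congrArg (fun l : E3 →L[ℝ] ℂ => l (EuclideanSpace.single k 1)) this
  have hmeas : MeasurableSet (unitCell L \ closure (crystal L D)) :=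
    (measurableSet_Icc.preimage (by fun_prop : Measurable fun x : E3 => x 0)).diff
      isClosed_closure.measurableSet
  refine integral_conj.symm.trans (setIntegral_congr_fun hmeas fun x hx => ?_)
  simp only [map_sum, map_mul]
  exact Finset.sum_congr rfl fun k _ => by rw [hderiv i k hx.2, hderiv j k hx.2, hderiv i k hx.2]

/-! ### The complementary dimer -/

/-- Closures lie strictly inside one cell, so only the shift `m = 0` can interfere; there openness
(same resonator) or disjointness of closures (different ones) decides. -/
theorem IsSymmetricDimer.frontier_disjoint_crystal {L x₁ : ℝ} (hL : 0 < L) {D : Fin 2 → Set E3}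
    (hD : IsSymmetricDimer L x₁ D) (i : Fin 2) (x : E3) (hx : x ∈ frontier (D i)) :
    x ∉ crystal L D := by
  rintro ⟨m, k, hm⟩
  have hx₁ := hD.closure_subset i (frontier_subset_closure hx)
  have hx₂ := hD.closure_subset k (subset_closure hm)
  simp only [Set.mem_ofPred_eq, Set.mem_Ioo, PiLp.sub_apply, PiLp.smul_apply, e₁_zero,
    smul_eq_mul, mul_one] at hx₁ hx₂
  have hm₁ : (m : ℝ) < 1 := by
    by_contra! h
    nlinarith
  have hm₂ : (-1 : ℝ) < m := by
    by_contra! h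
    nlinarith
  have hm0 : m = 0 := by
    have h₁ : m < 1 := by exact_mod_cast hm₁
    have h₂ : -1 < m := by exact_mod_cast hm₂
    omega
  subst hm0
  simp only [Int.cast_zero, zero_mul, zero_smul, sub_zero] at hm
  by_cases hik : i = k
  · subst hik
    rw [(hD.isOpen i).frontier_eq] at hx
    exact hx.2 hm
  · have h₁ := frontier_subset_closure hx
    have h₂ := subset_closure hm
    fin_cases i <;> fin_cases k <;> first
      | exact hik rfl
      | exact Set.disjoint_left.1 hD.disjoint h₁ h₂
      | exact Set.disjoint_left.1 hD.disjoint h₂ h₁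

/-- Reflecting in the plane at `a` and then in the one at `b` is translation by `2 * (b - a)`, and
the first reflection preserves `A`. -/
theorem image_add_eq_planeReflection_image {a b s : ℝ} (hs : s = 2 * (b - a)) {A : Set E3}
    (hA : planeReflection a '' A = A) :
    (fun x => x + s • e₁) '' A = planeReflection b '' A := by
  conv_rhs => rw [← hA, Set.image_image]
  refine Set.image_congr fun x _ => ?_
  simp only [planeReflection, PiLp.add_apply, PiLp.smul_apply, e₁_zero, smul_eq_mul, hs]
  module

theorem mem_planeReflection_image_iff (c : ℝ) (A : Set E3) (x : E3) :
    x ∈ planeReflection c '' A ↔ planeReflection c x ∈ A := by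
  constructor
  · rintro ⟨y, hy, rfl⟩
    rwa [planeReflection_involutive c y]
  · exact fun h => ⟨_, h, planeReflection_involutive c x⟩

theorem IsSymmetricDimer.complementaryDimer_eq {L x₁ : ℝ} {D : Fin 2 → Set E3}
    (hD : IsSymmetricDimer L x₁ D) :
    complementaryDimer L x₁ D 0 = planeReflection (-(L / 4)) '' D 0 ∧
      complementaryDimer L x₁ D 1 = planeReflection (L / 4) '' D 1 :=
  ⟨image_add_eq_planeReflection_image (by simp only [separation, separation']; ring)
      hD.reflection_left,
    image_add_eq_planeReflection_image (by simp only [separation, separation']; ring)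
      hD.reflection_right⟩

/-- Reflection at `-L/4` is reflection at `L/4` followed by a shift by `-L`; hence one cell for `D
0` and none for `D 1`. This single shift produces the factor `e^{-iαL}`. -/
theorem IsSymmetricDimer.isReflectedDimer {L x₁ : ℝ} {D : Fin 2 → Set E3}
    (hD : IsSymmetricDimer L x₁ D) :
    IsReflectedDimer L (L / 4) ![1, 0] D (complementaryDimer L x₁ D) := by
  intro i x
  fin_cases i
  · change x ∈ complementaryDimer L x₁ D 0 ↔ _
    rw [hD.complementaryDimer_eq.1, mem_planeReflection_image_iff]
    have : planeReflection (-(L / 4)) x = planeReflection (L / 4) x - (((1 : ℤ) : ℝ) * L) • e₁ := by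
      simp only [planeReflection]
      push_cast
      module
    rw [this]
    rfl
  · change x ∈ complementaryDimer L x₁ D 1 ↔ _
    rw [hD.complementaryDimer_eq.2, mem_planeReflection_image_iff]
    simp

theorem capacitance_complementaryDimer {L x₁ : ℝ} (hL : 0 < L) {D : Fin 2 → Set E3}
    (hD : IsSymmetricDimer L x₁ D) (α : ℝ) :
    capacitance L α (complementaryDimer L x₁ D) 0 1 =
      Complex.exp (-(Complex.I * α * L)) * starRingEnd ℂ (capacitance L α D 0 1) := by
  rw [capacitance_reflect hL hD.isReflectedDimer hD.isOpen hD.isBounded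
    (hD.frontier_disjoint_crystal hL), conj_phase]
  simp

theorem complementaryDimer_of_separation_eq {L x₁ : ℝ} {D : Fin 2 → Set E3}
    (h : separation x₁ = separation' L x₁) : complementaryDimer L x₁ D = D := by
  funext i
  fin_cases i <;> simp [complementaryDimer, h]

end ResonatorChain

end

theorem lemma3p4 (L x₁ : ℝ) (hL : 0 < L) (D : Fin 2 → Set ResonatorChain.E3)
    (hD : ResonatorChain.IsSymmetricDimer L x₁ D) :
    (ResonatorChain.complementaryDimer L x₁ D 0 =
        ResonatorChain.planeReflection (-(L / 4)) '' D 0 ∧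
      ResonatorChain.complementaryDimer L x₁ D 1 =
        ResonatorChain.planeReflection (L / 4) '' D 1) ∧
    (∀ α : ℝ,
      ResonatorChain.capacitance L α (ResonatorChain.complementaryDimer L x₁ D) 0 1 =
        Complex.exp (-(Complex.I * α * L)) *
          starRingEnd ℂ (ResonatorChain.capacitance L α D 0 1)) ∧
    (ResonatorChain.separation x₁ = L / 2 → ResonatorChain.separation' L x₁ = L / 2 →
      ResonatorChain.capacitance L (Real.pi / L) D 0 1 = 0) := by
  refine ⟨hD.complementaryDimer_eq, ResonatorChain.capacitance_complementaryDimer hL hD, ?_⟩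
  intro h h'
  have hC := ResonatorChain.capacitance_complementaryDimer hL hD (Real.pi / L)
  have hphase : Complex.exp (-(Complex.I * (Real.pi / L : ℝ) * L)) = -1 := by
    have : (L : ℂ) ≠ 0 := Complex.ofReal_ne_zero.2 hL.ne'
    rw [show -(Complex.I * (Real.pi / L : ℝ) * L) = -(Real.pi * Complex.I) by
      push_cast; field_simp, Complex.exp_neg, Complex.exp_pi_mul_I]
    norm_num
  -- Self-complementarity, the phase `-1` and reality turn `hC` into `C₁₂ = -C₁₂`.
  rw [ResonatorChain.complementaryDimer_of_separation_eq (h.trans h'.symm), hphase,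
    ResonatorChain.conj_capacitance_pi_div hL hD.isOpen hD.isBounded] at hC
  linear_combination hC / 2
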